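/- Let $q=2^m$ with $m\ge 3$, let $h$ be a positive integer with $\gcd(m,h)=1$, let $\alpha$ be a generator of $\mathbb F_q^*$, and let $\mathcal C_D\subseteq\mathbb F_q^{\,q-1}$ be the linear code spanned over $\mathbb F_q$ by the three rows of the $3\times(q-1)$ matrix whose $i$-th column is $(1,\,x,\,x^{2^h+1})^T$ with $x=\alpha^i$, $1\le i\le q-1$. Conventions. An $[n,k,d]$ code is a $k$-dimensional subspace of $\mathbb F_q^n$ with minimum Hamming distance $d$; $\mathcal C^\perp$ is the dual for the standard inner product. A code is NMDS (near maximum distance separable) if it is an $[n,k,n-k]$ code and its dual is an $[n,n-k,k]$ code. The weight enumerator is $A(z)=\sum_{w=0}^n A_wz^w$, where $A_w$ is the number of codewords of Hamming weight $w$. For $w\ge1$ let $\mathcal B_w(\mathcal C)$ be the multiset of the supports of all codewords of weight $w$ in $\mathcal C$, with every multiplicity divided by $q-1$. The codewords of weight $w$ in $\mathcal C$ support a $t$-$(n,w,\lambda)$ design if every $t$-subset of the set of $n$ coordinate positions is contained in exactly $\lambda$ members of $\mathcal B_w(\mathcal C)$, counted with multiplicity; the design is simple if $\mathcal B_w(\mathcal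 C)$ has no repeated members. A Steiner system $S(t,k,n)$ is a $t$-$(n,k,1)$ design with $t\ge2$. Then $\mathcal C_D$ is a $[q-1,3,q-4]$ NMDS code over $\mathbb F_q$ with weight enumerator $$A(z)=1+\frac{(q-1)^2(q-2)}{6}\,z^{q-4}+\frac{(q-1)^2(q+4)}{2}\,z^{q-2}+\frac{(q-1)(q^2+8)}{3}\,z^{q-1}.$$ Moreover, the minimum weight codewords of $\mathcal C_D$ (those of weight $q-4$) support a simple $2$-$\left(q-1,\,q-4,\,\frac{(q-4)(q-5)}{6}\right)$ design. The dual $\mathcal C_D^\perp$ is a $[q-1,q-4,3]$ code, and its minimum weight codewords (those of weight $3$) support a simple $2$-$(q-1,3,1)$ design, i.e. a Steiner system $S(2,3,q-1)$. Furthermore, the codewords of weight $4$ in $\mathcal C_D^\perp$ support a simple $2$-$\left(q-1,\,4,\,\frac{(q-4)(q-7)}{2}\right)$ design. -/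

import Mathlib

open Polynomial

namespace CodeDesign

variable {ι F : Type*} [Fintype ι] [DecidableEq ι] [Field F] [Fintype F] [DecidableEq F]

/-- The dual `C^⊥` of a linear code with respect to the standard inner product. -/
def dual (C : Submodule F (ι → F)) : Submodule F (ι → F) where
  carrier := {u | ∀ c ∈ C, u ⬝ᵥ c = 0}
  add_mem' := by
    intro a b ha hb c hc
    rw [add_dotProduct, ha c hc, hb c hc, add_zero]
  zero_mem' := by
    intro c _
    exact zero_dotProduct c
  smul_mem' := by
    intro r a ha c hc
    rw [smul_dotProduct, ha c hc, smul_zero]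

/-- `C` is an `[n, k, d]` linear code: its length is `n`, its dimension is `k`, and `d` is the
minimum Hamming distance between two distinct codewords. -/
def IsLinearCode (C : Submodule F (ι → F)) (n k d : ℕ) : Prop :=
  Fintype.card ι = n ∧ Module.finrank F C = k ∧
    IsLeast {e : ℕ | ∃ x ∈ C, ∃ y ∈ C, x ≠ y ∧ hammingDist x y = e} d

/-- Almost maximum distance separable: an `[n, k, n - k]` code for its length `n` and its
dimension `k` (the subtraction is exact, as `k ≤ n`). -/
def IsAMDS (C : Submodule F (ι → F)) : Prop :=
  IsLinearCode C (Fintype.card ι) (Module.finrank F C)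
    (Fintype.card ι - Module.finrank F C)

/-- Near maximum distance separable: the code and its dual are both AMDS. -/
def IsNMDS (C : Submodule F (ι → F)) : Prop :=
  IsAMDS C ∧ IsAMDS (dual C)

/-- The number `A_w` of codewords of Hamming weight `w`. -/
noncomputable def numWords (C : Submodule F (ι → F)) (w : ℕ) : ℕ :=
  Set.ncard {c : ι → F | c ∈ C ∧ hammingNorm c = w}

/-- The weight enumerator `A_0 + A_1 z + ⋯ + A_n z ^ n`. -/
noncomputable def weightEnumerator (C : Submodule F (ι → F)) : ℚ[X] :=
  ∑ w ∈ Finset.range (Fintype.card ι + 1), Polynomial.C (numWords C w : ℚ) * X ^ w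

/-- The support of a vector. -/
def support (c : ι → F) : Finset ι :=
  Finset.univ.filter fun i => c i ≠ 0

/-- The multiset of the supports of the codewords of weight `w`, one for each codeword. -/
noncomputable def supports (C : Submodule F (ι → F)) (w : ℕ) : Multiset (Finset ι) :=
  (Set.toFinite {c : ι → F | c ∈ C ∧ hammingNorm c = w}).toFinset.val.map support

/-- The multiset `B_w(C)` of blocks: all multiplicities in `supports C w` divided by `q - 1`,
where `q` is the size of the field. For `w ≥ 1` these divisions are exact, because the nonzero
scalars act freely on the codewords with a given nonempty support. -/
noncomputable def blocks (C : Submodule F (ι → F)) (w : ℕ) : Multiset (Finset ι) :=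
  ∑ s : Finset ι, Multiset.replicate ((supports C w).count s / (Fintype.card F - 1)) s

/-- The multiset `B` of subsets of the point set `ι` is a `t`-`(n, k, l)` design. -/
def IsDesign (B : Multiset (Finset ι)) (t n k l : ℕ) : Prop :=
  1 ≤ t ∧ t ≤ k ∧ k ≤ n ∧ Fintype.card ι = n ∧ (∀ b ∈ B, b.card = k) ∧
    ∀ T : Finset ι, T.card = t → (B.filter fun b => T ⊆ b).card = l

/-- A design without repeated blocks. -/
def IsSimpleDesign (B : Multiset (Finset ι)) (t n k l : ℕ) : Prop :=
  IsDesign B t n k l ∧ B.Nodup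

/-- A Steiner system `S(t, k, n)`. -/
def IsSteinerSystem (B : Multiset (Finset ι)) (t k n : ℕ) : Prop :=
  2 ≤ t ∧ IsDesign B t n k 1

/-- The `3 × (q - 1)` matrix whose `i`-th column, for `1 ≤ i ≤ q - 1`, is
`(1, x, x ^ (2 ^ h + 1))` with `x = α ^ i`. The index `i : Fin (q - 1)` starts at `0`. -/
def matrixD (α : Fˣ) (h q : ℕ) : Matrix (Fin 3) (Fin (q - 1)) F :=
  ![fun _ => 1,
    fun i => (α : F) ^ (i.val + 1),
    fun i => ((α : F) ^ (i.val + 1)) ^ (2 ^ h + 1)]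

/-- The linear code generated by the rows of `matrixD`. -/
def codeD (α : Fˣ) (h q : ℕ) : Submodule F (Fin (q - 1) → F) :=
  Submodule.span F (Set.range (matrixD α h q).row)

end CodeDesign

/-!
Write `σ x = x ^ 2 ^ h`. As `gcd (m, h) = 1`, this is an automorphism of the field that fixes only
`0` and `1`. The columns of the generator matrix are the points `(1, x, x * σ x)`, `x ≠ 0`, of the
projective plane. A point of the line through those of `x` and `y` has the same form exactly if its
parameter `r` on the line satisfies `x * r = y * σ r`; since `s ↦ σ s / s` is a bijection on the
units, there is one such `r ≠ 0` (`exists_mul_eq_mul_map`), so that the line through any two of the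
points contains exactly one further point (`exists_third_root`). This is the property
`HasThirdPoints`, and everything else follows from it and from the dimension being three.

A nonzero codeword vanishes at `0`, `1` or `3` coordinates, and the zero sets of size three form a
Steiner triple system (`HasThirdPoints.isTripleSystem`). The supports of the codewords of minimum
weight are the complements of its blocks, the supports of the dual words of weight three are the
blocks, and those of the dual words of weight four are the four-element sets that contain no block.
In each case words with the same support are proportional, so that the multiset of blocks is the
set of supports (`blocks_eq_supportSet`), and the parameters of the designs are counts in a Steiner
triple system. The weight distribution is found from the number of triples, the number of codewords
and the total number of zeros of all codewords.
-/

set_option linter.unusedSectionVars false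

namespace CodeDesign

/-! ### Steiner triple systems -/

/-- A Steiner triple system on `ι`: a family of three-element blocks such that any two distinct
points lie on exactly one block. -/
def IsTripleSystem {ι : Type*} (B : Finset (Finset ι)) : Prop :=
  (∀ b ∈ B, b.card = 3) ∧ ∀ i j, i ≠ j → ∃! b, b ∈ B ∧ i ∈ b ∧ j ∈ b

section TripleSystem

variable {ι : Type*} {B : Finset (Finset ι)}

theorem IsTripleSystem.eq_of_mem (hB : IsTripleSystem B) {b b' : Finset ι} (hb : b ∈ B)
    (hb' : b' ∈ B) {i j : ι} (hij : i ≠ j) (h1 : i ∈ b) (h2 : j ∈ b) (h3 : i ∈ b') (h4 : j ∈ b') :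
    b = b' :=
  (hB.2 i j hij).unique ⟨hb, h1, h2⟩ ⟨hb', h3, h4⟩

variable [DecidableEq ι]

theorem IsTripleSystem.exists_third (hB : IsTripleSystem B) {i j : ι} (hij : i ≠ j) :
    ∃ k, k ≠ i ∧ k ≠ j ∧ ({i, j, k} : Finset ι) ∈ B := by
  obtain ⟨b, ⟨hb, hi, hj⟩, -⟩ := hB.2 i j hij
  have hj' : j ∈ b.erase i := Finset.mem_erase.2 ⟨hij.symm, hj⟩
  have hc : ((b.erase i).erase j).card = 1 := by
    rw [Finset.card_erase_of_mem hj', Finset.card_erase_of_mem hi, hB.1 b hb]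
  obtain ⟨k, hk⟩ := Finset.card_eq_one.1 hc
  have hk' : k ∈ (b.erase i).erase j := by simp [hk]
  simp only [Finset.mem_erase] at hk'
  refine ⟨k, hk'.2.1, hk'.1, ?_⟩
  have : b = {i, j, k} := by
    rw [← Finset.insert_erase hi, ← Finset.insert_erase hj', hk]
  rwa [← this]

/-- If `{x, y, z}`, `{x, w, s}` and `{y, w, t}` are blocks, the sets `{x, y, w, a}` that
contain no block are those with `a` outside `{x, y, z, w, s, t}`. -/
theorem IsTripleSystem.not_subset_insert_insert (hB : IsTripleSystem B) {x y z w s t a : ι}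
    (hxy : x ≠ y) (hxw : x ≠ w) (hyw : y ≠ w) (hz : ({x, y, z} : Finset ι) ∈ B)
    (hs : ({x, w, s} : Finset ι) ∈ B) (ht : ({y, w, t} : Finset ι) ∈ B) (hwz : w ≠ z)
    (ha : a ∉ ({x, y, z, w, s, t} : Finset ι)) :
    ∀ b ∈ B, ¬ b ⊆ {x, y, w, a} := by
  simp only [Finset.mem_insert, Finset.mem_singleton, not_or] at ha
  obtain ⟨ax, ay, az, aw, as, at'⟩ := ha
  have avoid : ∀ b ∈ B, ∀ i j k l, i ≠ j → ({i, j, k} : Finset ι) ∈ B → i ∈ b → j ∈ b →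
      l ≠ i → l ≠ j → l ≠ k → l ∉ b := by
    intro b hb i j k l hij hk hi hj h1 h2 h3 hl
    rw [hB.eq_of_mem hb hk hij hi hj (by simp) (by simp)] at hl
    simp only [Finset.mem_insert, Finset.mem_singleton] at hl
    rcases hl with h | h | h <;> contradiction
  intro b hb hbS
  -- `b` contains one of any two distinct points of the four
  have miss : ∀ i ∈ ({x, y, w, a} : Finset ι), ∀ j ∈ ({x, y, w, a} : Finset ι),
      i ≠ j → i ∈ b ∨ j ∈ b := by
    intro i hi j hj hij
    by_contra! hcon
    have hsub : b ⊆ (({x, y, w, a} : Finset ι).erase i).erase j := by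
      intro k hk
      simp only [Finset.mem_erase]
      exact ⟨fun e => hcon.2 (e ▸ hk), fun e => hcon.1 (e ▸ hk), hbS hk⟩
    have h1 := Finset.card_le_card hsub
    rw [Finset.card_erase_of_mem (Finset.mem_erase.2 ⟨hij.symm, hj⟩),
      Finset.card_erase_of_mem hi, hB.1 b hb] at h1
    have : ({x, y, w, a} : Finset ι).card ≤ 4 := Finset.card_le_four
    omega
  have m1 : ¬ (x ∈ b ∧ y ∈ b) := by
    rintro ⟨p, r⟩
    rcases miss w (by simp) a (by simp) (Ne.symm aw) with m | m
    · exact avoid b hb x y z w hxy hz p r hxw.symm hyw.symm hwz m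
    · exact avoid b hb x y z a hxy hz p r ax ay az m
  have m2 := miss x (by simp) y (by simp) hxy
  have m3 : w ∈ b := by
    have h1 := miss x (by simp) w (by simp) hxw
    have h2 := miss y (by simp) w (by simp) hyw
    tauto
  have m4 : a ∈ b := by
    have h1 := miss x (by simp) a (by simp) (Ne.symm ax)
    have h2 := miss y (by simp) a (by simp) (Ne.symm ay)
    tauto
  rcases m2 with m | m
  · exact avoid b hb x w s a hxw hs m m3 ax aw as m4
  · exact avoid b hb y w t a hyw ht m m3 ay aw at' m4

theorem IsTripleSystem.card_filter_mem_mem (hB : IsTripleSystem B) {i j : ι} (hij : i ≠ j) :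
    (B.filter fun b => i ∈ b ∧ j ∈ b).card = 1 := by
  obtain ⟨b, hb, hu⟩ := hB.2 i j hij
  rw [Finset.card_eq_one]
  refine ⟨b, Finset.eq_singleton_iff_unique_mem.2 ⟨by simpa using hb, fun c hc => hu c ?_⟩⟩
  simpa using hc

variable [Fintype ι]

theorem IsTripleSystem.two_mul_card_filter_mem (hB : IsTripleSystem B) (x : ι) :
    2 * (B.filter fun b => x ∈ b).card + 1 = Fintype.card ι := by
  have h := Finset.sum_card_bipartiteAbove_eq_sum_card_bipartiteBelow
    (s := B.filter fun b => x ∈ b) (t := Finset.univ.erase x) (fun b y => y ∈ b)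
  have h1 : ∀ b ∈ B.filter (fun b => x ∈ b),
      (Finset.bipartiteAbove (fun b y => y ∈ b) (Finset.univ.erase x) b).card = 2 := by
    intro b hb
    rw [Finset.mem_filter] at hb
    have : Finset.bipartiteAbove (fun b y => y ∈ b) (Finset.univ.erase x) b = b.erase x := by
      ext y; simp [Finset.bipartiteAbove]
    rw [this, Finset.card_erase_of_mem hb.2, hB.1 b hb.1]
  have h2 : ∀ y ∈ Finset.univ.erase x,
      (Finset.bipartiteBelow (fun b y => y ∈ b) (B.filter fun b => x ∈ b) y).card = 1 := by
    intro y hy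
    rw [← hB.card_filter_mem_mem (Finset.ne_of_mem_erase hy).symm, Finset.bipartiteBelow,
      Finset.filter_filter]
  rw [Finset.sum_congr rfl h1, Finset.sum_congr rfl h2] at h
  have hpos : 0 < Fintype.card ι := Fintype.card_pos_iff.2 ⟨x⟩
  simp at h
  omega

theorem IsTripleSystem.six_mul_card (hB : IsTripleSystem B) :
    6 * B.card = Fintype.card ι * (Fintype.card ι - 1) := by
  have h := Finset.sum_card_bipartiteAbove_eq_sum_card_bipartiteBelow
    (s := B) (t := Finset.univ) (fun b y => y ∈ b)
  have h1 : ∀ b ∈ B, (Finset.bipartiteAbove (fun b y => y ∈ b) Finset.univ b).card = 3 := by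
    intro b hb
    rw [← hB.1 b hb]
    congr 1
    ext y; simp [Finset.bipartiteAbove]
  rw [Finset.sum_congr rfl h1] at h
  have h2 : ∀ y ∈ (Finset.univ : Finset ι),
      2 * (Finset.bipartiteBelow (fun b y => y ∈ b) B y).card = Fintype.card ι - 1 := by
    intro y _
    have := hB.two_mul_card_filter_mem y
    rw [Finset.bipartiteBelow]
    omega
  have h3 := Finset.sum_congr rfl h2
  rw [← Finset.mul_sum, ← h] at h3
  simp at h3
  omega

/-- The number of blocks that avoid two given points, by inclusion and exclusion. -/
theorem IsTripleSystem.six_mul_card_filter_notMem (hB : IsTripleSystem B) {x y : ι}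
    (hxy : x ≠ y) (hn : 4 ≤ Fintype.card ι) :
    6 * (B.filter fun b => x ∉ b ∧ y ∉ b).card =
      (Fintype.card ι - 3) * (Fintype.card ι - 4) := by
  have h1 := hB.two_mul_card_filter_mem x
  have h2 := hB.two_mul_card_filter_mem y
  have h3 := hB.card_filter_mem_mem hxy
  have h4 := hB.six_mul_card
  have h5 : (B.filter fun b => x ∈ b ∨ y ∈ b).card + (B.filter fun b => x ∈ b ∧ y ∈ b).card =
      (B.filter fun b => x ∈ b).card + (B.filter fun b => y ∈ b).card := by
    rw [Finset.filter_or, Finset.filter_and, Finset.card_union_add_card_inter]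
  have h6 := Finset.card_filter_add_card_filter_not (s := B) (fun b => x ∈ b ∨ y ∈ b)
  simp only [not_or] at h6
  obtain ⟨n, hn'⟩ := Nat.exists_eq_add_of_le hn
  rw [hn'] at h1 h2 h4 ⊢
  have e1 : 4 + n - 3 = n + 1 := by omega
  have e2 : 4 + n - 4 = n := by omega
  have e3 : 4 + n - 1 = n + 3 := by omega
  rw [e1, e2]
  rw [e3] at h4
  nlinarith

/-- The number of four-element sets through three given points not on a block that contain no
block: the fourth point avoids the three points and the third points of the blocks through any
two of them. -/
theorem IsTripleSystem.card_four_sets_three_points (hB : IsTripleSystem B) {x y z w : ι}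
    (hxy : x ≠ y) (hzx : z ≠ x) (hzy : z ≠ y) (hz : ({x, y, z} : Finset ι) ∈ B)
    (hwx : w ≠ x) (hwy : w ≠ y) (hwz : w ≠ z) :
    (Finset.univ.filter fun S : Finset ι =>
      ((S.card = 4 ∧ ∀ b ∈ B, ¬ b ⊆ S) ∧ x ∈ S ∧ y ∈ S) ∧ w ∈ S).card =
      Fintype.card ι - 6 := by
  obtain ⟨s, hsx, hsw, hs⟩ := hB.exists_third hwx.symm
  obtain ⟨t, hty, htw, ht⟩ := hB.exists_third hwy.symm
  -- a block through two points of `{x, y, z}` does not contain `w`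
  have key : ∀ b ∈ B, ∀ i j, i ≠ j → i ∈ b → j ∈ b → i ∈ ({x, y, z} : Finset ι) →
      j ∈ ({x, y, z} : Finset ι) → w ∈ b → False := by
    intro b hb i j hij hi hj hi' hj' hw
    rw [hB.eq_of_mem hb hz hij hi hj hi' hj'] at hw
    simp only [Finset.mem_insert, Finset.mem_singleton] at hw
    rcases hw with h | h | h <;> contradiction
  have hsy : s ≠ y := by
    rintro rfl
    exact key _ hs x s hxy (by simp) (by simp) (by simp) (by simp) (by simp)
  have hsz : s ≠ z := by
    rintro rfl
    exact key _ hs x s hsx.symm (by simp) (by simp) (by simp) (by simp) (by simp)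
  have htx : t ≠ x := by
    rintro rfl
    exact key _ ht t y hxy (by simp) (by simp) (by simp) (by simp) (by simp)
  have htz : t ≠ z := by
    rintro rfl
    exact key _ ht y t hty.symm (by simp) (by simp) (by simp) (by simp) (by simp)
  have hst : s ≠ t := by
    rintro rfl
    have hx : x ∈ ({y, w, s} : Finset ι) := by
      rw [← hB.eq_of_mem hs ht hsw.symm (by simp) (by simp) (by simp) (by simp)]; simp
    simp only [Finset.mem_insert, Finset.mem_singleton] at hx
    rcases hx with h | h | h
    · exact hxy h
    · exact hwx h.symm
    · exact hsx h.symm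
  have h6 : ({x, y, z, w, s, t} : Finset ι).card = 6 := by
    simp [Finset.card_insert_of_notMem, hst, htw.symm, hsw.symm, hwz.symm, hsz.symm, htz.symm,
      hzy.symm, hwy.symm, hsy.symm, hty.symm, hxy, hzx.symm, hwx.symm, hsx.symm, htx.symm]
  rw [← h6, ← Finset.card_univ, ← Finset.card_sdiff_of_subset (Finset.subset_univ _)]
  symm
  refine Finset.card_bij (fun a _ => ({x, y, w, a} : Finset ι)) ?_ ?_ ?_
  · intro a ha
    have ha' : a ∉ ({x, y, z, w, s, t} : Finset ι) := (Finset.mem_sdiff.1 ha).2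
    rw [Finset.mem_filter]
    refine ⟨Finset.mem_univ _, ⟨⟨?_, ?_⟩, by simp, by simp⟩, by simp⟩
    · simp only [Finset.mem_insert, Finset.mem_singleton, not_or] at ha'
      simp [Finset.card_insert_of_notMem, hxy, hwx.symm, hwy.symm, Ne.symm ha'.1,
        Ne.symm ha'.2.1, Ne.symm ha'.2.2.2.1]
    · exact hB.not_subset_insert_insert hxy hwx.symm hwy.symm hz hs ht hwz ha'
  · intro a ha a' _ hE
    simp only [Finset.mem_sdiff, Finset.mem_univ, true_and, Finset.mem_insert,
      Finset.mem_singleton, not_or] at ha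
    have hE' : ({x, y, w, a} : Finset ι) = {x, y, w, a'} := hE
    have : a ∈ ({x, y, w, a'} : Finset ι) := by rw [← hE']; simp
    simp only [Finset.mem_insert, Finset.mem_singleton] at this
    rcases this with h | h | h | h
    · exact absurd h ha.1
    · exact absurd h ha.2.1
    · exact absurd h ha.2.2.2.1
    · exact h
  · intro S hS
    obtain ⟨⟨⟨hS4, hSB⟩, hx, hy⟩, hw⟩ := (Finset.mem_filter.1 hS).2
    have hy' : y ∈ S.erase x := Finset.mem_erase.2 ⟨hxy.symm, hy⟩
    have hw' : w ∈ (S.erase x).erase y :=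
      Finset.mem_erase.2 ⟨hwy, Finset.mem_erase.2 ⟨hwx, hw⟩⟩
    have hc : (((S.erase x).erase y).erase w).card = 1 := by
      rw [Finset.card_erase_of_mem hw', Finset.card_erase_of_mem hy', Finset.card_erase_of_mem hx,
        hS4]
    obtain ⟨k, hk⟩ := Finset.card_eq_one.1 hc
    have hk' : k ∈ ((S.erase x).erase y).erase w := by simp [hk]
    simp only [Finset.mem_erase] at hk'
    obtain ⟨kw, ky, kx, kS⟩ := hk'
    have sub3 : ∀ i j l, i ∈ S → j ∈ S → l ∈ S → ({i, j, l} : Finset ι) ∉ B := by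
      intro i j l hi hj hl hb
      refine hSB _ hb ?_
      intro a; simp only [Finset.mem_insert, Finset.mem_singleton]
      rintro (rfl | rfl | rfl) <;> assumption
    refine ⟨k, ?_, ?_⟩
    · simp only [Finset.mem_sdiff, Finset.mem_univ, true_and, Finset.mem_insert,
        Finset.mem_singleton, not_or]
      refine ⟨kx, ky, ?_, kw, ?_, ?_⟩
      · rintro rfl; exact sub3 _ _ _ hx hy kS hz
      · rintro rfl; exact sub3 _ _ _ hx hw kS hs
      · rintro rfl; exact sub3 _ _ _ hy hw kS ht
    · show ({x, y, w, k} : Finset ι) = S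
      rw [← Finset.insert_erase hx, ← Finset.insert_erase hy', ← Finset.insert_erase hw', hk]

/-- The number of four-element sets through two given points that contain no block, by double
counting the pairs of such a set and one of its other two points. -/
theorem IsTripleSystem.two_mul_card_four_sets (hB : IsTripleSystem B) {x y : ι}
    (hxy : x ≠ y) :
    2 * (Finset.univ.filter fun S : Finset ι =>
      (S.card = 4 ∧ ∀ b ∈ B, ¬ b ⊆ S) ∧ x ∈ S ∧ y ∈ S).card =
      (Fintype.card ι - 3) * (Fintype.card ι - 6) := by
  obtain ⟨z, hzx, hzy, hz⟩ := hB.exists_third hxy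
  have hAc : (Finset.univ \ {x, y, z} : Finset ι).card = Fintype.card ι - 3 := by
    rw [Finset.card_sdiff_of_subset (Finset.subset_univ _), Finset.card_univ, hB.1 _ hz]
  have h := Finset.sum_card_bipartiteAbove_eq_sum_card_bipartiteBelow
    (s := Finset.univ.filter fun S : Finset ι =>
      (S.card = 4 ∧ ∀ b ∈ B, ¬ b ⊆ S) ∧ x ∈ S ∧ y ∈ S)
    (t := Finset.univ \ {x, y, z}) (fun b y => y ∈ b)
  have h1 : ∀ S ∈ Finset.univ.filter (fun S : Finset ι =>
      (S.card = 4 ∧ ∀ b ∈ B, ¬ b ⊆ S) ∧ x ∈ S ∧ y ∈ S),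
      (Finset.bipartiteAbove (fun b y => y ∈ b) (Finset.univ \ {x, y, z}) S).card = 2 := by
    intro S hS
    obtain ⟨⟨hS4, hSB⟩, hx, hy⟩ := (Finset.mem_filter.1 hS).2
    have hzS : z ∉ S := by
      intro hzS
      refine hSB _ hz ?_
      intro i; simp only [Finset.mem_insert, Finset.mem_singleton]
      rintro (rfl | rfl | rfl) <;> assumption
    have : Finset.bipartiteAbove (fun b y => y ∈ b) (Finset.univ \ {x, y, z}) S =
        (S.erase x).erase y := by
      ext i
      simp only [Finset.bipartiteAbove, Finset.mem_filter, Finset.mem_sdiff, Finset.mem_univ,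
        true_and, Finset.mem_insert, Finset.mem_singleton, Finset.mem_erase, not_or]
      constructor
      · rintro ⟨⟨h1, h2, -⟩, h3⟩
        exact ⟨h2, h1, h3⟩
      · rintro ⟨h1, h2, h3⟩
        exact ⟨⟨h2, h1, fun h => hzS (h ▸ h3)⟩, h3⟩
    rw [this, Finset.card_erase_of_mem (Finset.mem_erase.2 ⟨hxy.symm, hy⟩),
      Finset.card_erase_of_mem hx, hS4]
  have h2 : ∀ w ∈ (Finset.univ \ {x, y, z} : Finset ι),
      (Finset.bipartiteBelow (fun b y => y ∈ b) (Finset.univ.filter fun S : Finset ι =>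
        (S.card = 4 ∧ ∀ b ∈ B, ¬ b ⊆ S) ∧ x ∈ S ∧ y ∈ S) w).card = Fintype.card ι - 6 := by
    intro w hw
    simp only [Finset.mem_sdiff, Finset.mem_univ, true_and, Finset.mem_insert,
      Finset.mem_singleton, not_or] at hw
    rw [Finset.bipartiteBelow, Finset.filter_filter]
    exact hB.card_four_sets_three_points hxy hzx hzy hz hw.1 hw.2.1 hw.2.2
  rw [Finset.sum_congr rfl h1, Finset.sum_congr rfl h2, Finset.sum_const, Finset.sum_const, hAc,
    smul_eq_mul, smul_eq_mul] at h
  rw [mul_comm, h]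

end TripleSystem

/-! ### Supports of codewords -/

section Supports

variable {ι F : Type*} [Fintype ι] [Field F] [DecidableEq F]

/-- The set of zero coordinates of a vector. -/
def zeros (c : ι → F) : Finset ι :=
  Finset.univ.filter fun i => c i = 0

theorem mem_zeros {c : ι → F} {i : ι} : i ∈ zeros c ↔ c i = 0 := by simp [zeros]

theorem mem_support {c : ι → F} {i : ι} : i ∈ support c ↔ c i ≠ 0 := by simp [support]

theorem card_support (c : ι → F) : (support c).card = hammingNorm c := rfl

variable [DecidableEq ι]

theorem compl_zeros (c : ι → F) : (zeros c)ᶜ = support c := by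
  ext i; simp [mem_zeros, mem_support]

theorem hammingNorm_add_card_zeros (c : ι → F) :
    hammingNorm c + (zeros c).card = Fintype.card ι := by
  rw [← card_support, ← compl_zeros, Finset.card_compl_add_card]

/-- For a linear code the minimum distance is the minimum weight. -/
theorem isLeast_hammingDist {C : Submodule F (ι → F)} {d : ℕ}
    (hd : ∃ c ∈ C, c ≠ 0 ∧ hammingNorm c = d) (hle : ∀ c ∈ C, c ≠ 0 → d ≤ hammingNorm c) :
    IsLeast {e : ℕ | ∃ x ∈ C, ∃ y ∈ C, x ≠ y ∧ hammingDist x y = e} d := by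
  constructor
  · obtain ⟨c, hc, h0, hw⟩ := hd
    exact ⟨c, hc, 0, C.zero_mem, h0, by rw [hammingDist_zero_right, hw]⟩
  · rintro e ⟨x, hx, y, hy, hxy, rfl⟩
    rw [hammingDist_eq_hammingNorm]
    exact hle _ (C.add_mem (C.neg_mem hx) hy) (neg_add_eq_zero.not.2 hxy)

/-- The set of supports of the codewords of weight `w`. -/
noncomputable def supportSet (C : Submodule F (ι → F)) (w : ℕ) : Finset (Finset ι) :=
  open Classical in Finset.univ.filter fun s => ∃ c ∈ C, hammingNorm c = w ∧ support c = s

theorem mem_supportSet {C : Submodule F (ι → F)} {w : ℕ} {s : Finset ι} :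
    s ∈ supportSet C w ↔ ∃ c ∈ C, hammingNorm c = w ∧ support c = s := by
  classical
  simp [supportSet]

/-- Codewords of weight `w` with equal supports are proportional. -/
def SupportsDetermine (C : Submodule F (ι → F)) (w : ℕ) : Prop :=
  ∀ c ∈ C, ∀ c' ∈ C, hammingNorm c = w → hammingNorm c' = w → support c = support c' →
    ∃ r : F, c' = r • c

variable [Fintype F]

theorem count_supports_of_mem {C : Submodule F (ι → F)} {w : ℕ} (hw : 1 ≤ w)
    (hC : SupportsDetermine C w) {s : Finset ι} (hs : s ∈ supportSet C w) :
    (supports C w).count s = Fintype.card F - 1 := by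
  obtain ⟨c, hc, hcw, rfl⟩ := mem_supportSet.1 hs
  have hc0 : c ≠ 0 := by
    rintro rfl
    rw [hammingNorm_zero] at hcw
    omega
  rw [supports, Multiset.count_map, ← Fintype.card_units, ← Finset.card_univ]
  symm
  refine Finset.card_bij (t := Finset.filter (fun a => support c = support a)
    (Set.toFinite {c : ι → F | c ∈ C ∧ hammingNorm c = w}).toFinset)
    (fun r _ => (r : F) • c) ?_ ?_ ?_
  · intro r _
    have hsup : support ((r : F) • c) = support c := by
      ext i; simp [mem_support]
    simp only [Finset.mem_filter, Set.Finite.mem_toFinset, Set.mem_ofPred_eq]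
    exact ⟨⟨C.smul_mem _ hc, by rw [← card_support, hsup, card_support, hcw]⟩, hsup.symm⟩
  · intro r _ r' _ h
    exact Units.ext (smul_left_injective F hc0 h)
  · intro c' hc'
    simp only [Finset.mem_filter, Set.Finite.mem_toFinset, Set.mem_ofPred_eq] at hc'
    obtain ⟨r, hr⟩ := hC c hc c' hc'.1.1 hcw hc'.1.2 hc'.2
    have hr0 : r ≠ 0 := by
      rintro rfl
      have h2 := hc'.1.2
      rw [hr, zero_smul, hammingNorm_zero] at h2
      omega
    exact ⟨Units.mk0 r hr0, Finset.mem_univ _, hr.symm⟩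

theorem count_supports_of_notMem {C : Submodule F (ι → F)} {w : ℕ} {s : Finset ι}
    (hs : s ∉ supportSet C w) : (supports C w).count s = 0 := by
  rw [Multiset.count_eq_zero, supports]
  intro h
  obtain ⟨c, hc, rfl⟩ := Multiset.mem_map.1 h
  have hc' : c ∈ C ∧ hammingNorm c = w := by simpa using hc
  exact hs (mem_supportSet.2 ⟨c, hc'.1, hc'.2, rfl⟩)

theorem blocks_eq_supportSet {C : Submodule F (ι → F)} {w : ℕ} (hw : 1 ≤ w)
    (hC : SupportsDetermine C w) : blocks C w = (supportSet C w).val := by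
  have hF : 0 < Fintype.card F - 1 := Nat.sub_pos_of_lt Fintype.one_lt_card
  ext s
  rw [blocks, Multiset.count_sum']
  simp only [Multiset.count_replicate]
  rw [Finset.sum_ite_eq' Finset.univ s, if_pos (Finset.mem_univ _)]
  by_cases hs : s ∈ supportSet C w
  · rw [count_supports_of_mem hw hC hs, Nat.div_self hF,
      Multiset.count_eq_one_of_mem (supportSet C w).nodup hs]
  · rw [count_supports_of_notMem hs, Nat.zero_div, eq_comm, Multiset.count_eq_zero]
    exact hs

theorem numWords_eq {C : Submodule F (ι → F)} {w : ℕ} (hw : 1 ≤ w)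
    (hC : SupportsDetermine C w) :
    numWords C w = (Fintype.card F - 1) * (supportSet C w).card := by
  have h1 : numWords C w = (supports C w).card := by
    rw [numWords, Set.ncard_eq_toFinset_card _ (Set.toFinite _), supports, Multiset.card_map]
    rfl
  have h2 : ∑ s : Finset ι, (supports C w).count s = (supports C w).card :=
    Multiset.sum_count_eq_card fun _ _ => Finset.mem_univ _
  rw [h1, ← h2, ← Finset.sum_subset (Finset.subset_univ (supportSet C w))
    fun s _ hs => count_supports_of_notMem hs,
    Finset.sum_congr rfl fun s hs => count_supports_of_mem hw hC hs, Finset.sum_const,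
    smul_eq_mul, mul_comm]

theorem isSimpleDesign_blocks {C : Submodule F (ι → F)} {t w l : ℕ} (ht : 1 ≤ t) (htw : t ≤ w)
    (hw : w ≤ Fintype.card ι) (hC : SupportsDetermine C w)
    (hl : ∀ T : Finset ι, T.card = t → ((supportSet C w).filter fun b => T ⊆ b).card = l) :
    IsSimpleDesign (blocks C w) t (Fintype.card ι) w l := by
  rw [blocks_eq_supportSet (ht.trans htw) hC]
  refine ⟨⟨ht, htw, hw, rfl, ?_, hl⟩, (supportSet C w).nodup⟩
  intro b hb
  obtain ⟨c, -, hcw, rfl⟩ := mem_supportSet.1 hb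
  exact hcw

end Supports

/-! ### Codes of dimension three in which any two coordinates determine a third one -/

section ThirdPoint

variable {ι F : Type*} [Fintype ι] [DecidableEq ι] [Field F] [DecidableEq F]

/-- Any two distinct coordinates `i`, `j` have a third coordinate `k` such that the codewords
vanishing at `i` and `j` vanish at `k`, and such that the only one of them that vanishes anywhere
else is zero. In terms of the columns of a generator matrix of a code of dimension three, as
points of the projective plane: the line through any two of the points contains exactly three of
them. -/
def HasThirdPoints (C : Submodule F (ι → F)) : Prop :=
  ∀ i j, i ≠ j → ∃ k, k ≠ i ∧ k ≠ j ∧ ∀ c ∈ C, c i = 0 → c j = 0 →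
    c k = 0 ∧ ∀ l, l ≠ i → l ≠ j → l ≠ k → c l = 0 → c = 0

/-- The sets of three coordinates at which some nonzero codeword vanishes. -/
noncomputable def zeroTriples (C : Submodule F (ι → F)) : Finset (Finset ι) :=
  open Classical in
    Finset.univ.filter fun b => b.card = 3 ∧ ∃ c ∈ C, c ≠ 0 ∧ ∀ i ∈ b, c i = 0

theorem mem_zeroTriples {C : Submodule F (ι → F)} {b : Finset ι} :
    b ∈ zeroTriples C ↔ b.card = 3 ∧ ∃ c ∈ C, c ≠ 0 ∧ ∀ i ∈ b, c i = 0 := by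
  classical
  simp [zeroTriples]

variable {C : Submodule F (ι → F)}

theorem exists_mem_ne_zero_of_two_coordinates (h3 : Module.finrank F C = 3) (i j : ι) :
    ∃ c ∈ C, c ≠ 0 ∧ c i = 0 ∧ c j = 0 := by
  let f : C →ₗ[F] F × F :=
    ((LinearMap.proj i).comp C.subtype).prod ((LinearMap.proj j).comp C.subtype)
  have hf : LinearMap.ker f ≠ ⊥ := f.ker_ne_bot_of_finrank_lt (by
    rw [Module.finrank_prod, Module.finrank_self, h3]; norm_num)
  obtain ⟨c, hc, hc0⟩ := Submodule.exists_mem_ne_zero_of_ne_bot hf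
  have hc' : ((c : ι → F) i, (c : ι → F) j) = (0, 0) := hc
  exact ⟨c, c.2, fun h => hc0 (Subtype.ext h), (Prod.ext_iff.1 hc').1, (Prod.ext_iff.1 hc').2⟩

theorem HasThirdPoints.card_zeros (hC : HasThirdPoints C) {c : ι → F} (hc : c ∈ C) (h0 : c ≠ 0)
    (h2 : 1 < (zeros c).card) : (zeros c).card = 3 := by
  obtain ⟨i, hi, j, hj, hij⟩ := Finset.one_lt_card.1 h2
  rw [mem_zeros] at hi hj
  obtain ⟨k, hki, hkj, hk⟩ := hC i j hij
  obtain ⟨hck, hcl⟩ := hk c hc hi hj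
  rw [Finset.card_eq_three]
  refine ⟨i, j, k, hij, hki.symm, hkj.symm, ?_⟩
  ext l
  simp only [mem_zeros, Finset.mem_insert, Finset.mem_singleton]
  constructor
  · intro hl
    by_contra! hcon
    exact h0 (hcl l hcon.1 hcon.2.1 hcon.2.2 hl)
  · rintro (rfl | rfl | rfl) <;> assumption

theorem HasThirdPoints.card_zeros_le (hC : HasThirdPoints C) {c : ι → F} (hc : c ∈ C)
    (h0 : c ≠ 0) : (zeros c).card ≤ 3 := by
  by_cases h : 1 < (zeros c).card
  · exact (hC.card_zeros hc h0 h).le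
  · omega

theorem HasThirdPoints.zeros_eq (hC : HasThirdPoints C) {c : ι → F} (hc : c ∈ C) (h0 : c ≠ 0)
    {b : Finset ι} (hb : b.card = 3) (hz : ∀ i ∈ b, c i = 0) : zeros c = b :=
  (Finset.eq_of_subset_of_card_le (fun i hi => mem_zeros.2 (hz i hi))
    (hb ▸ hC.card_zeros_le hc h0)).symm

theorem HasThirdPoints.exists_smul (hC : HasThirdPoints C) {c c' : ι → F} (hc : c ∈ C)
    (hc' : c' ∈ C) (h0 : c ≠ 0) {i j : ι} (hij : i ≠ j) (hi : c i = 0) (hj : c j = 0)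
    (hi' : c' i = 0) (hj' : c' j = 0) : ∃ r : F, c' = r • c := by
  obtain ⟨l, hl⟩ := Function.ne_iff.1 h0
  have hl : c l ≠ 0 := hl
  obtain ⟨k, -, -, hk⟩ := hC i j hij
  have hd := (hk (c l • c' - c' l • c) (C.sub_mem (C.smul_mem _ hc') (C.smul_mem _ hc))
    (by simp [hi, hi']) (by simp [hj, hj'])).2 l (fun h => hl (h ▸ hi)) (fun h => hl (h ▸ hj))
    (fun h => hl (h ▸ (hk c hc hi hj).1)) (by simp [mul_comm])
  refine ⟨(c l)⁻¹ * c' l, ?_⟩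
  rw [mul_smul, ← sub_eq_zero.1 hd, smul_smul, inv_mul_cancel₀ hl, one_smul]

theorem HasThirdPoints.isTripleSystem (hC : HasThirdPoints C) (h3 : Module.finrank F C = 3) :
    IsTripleSystem (zeroTriples C) := by
  refine ⟨fun b hb => (mem_zeroTriples.1 hb).1, fun i j hij => ?_⟩
  obtain ⟨c, hc, h0, hi, hj⟩ := exists_mem_ne_zero_of_two_coordinates h3 i j
  have hcard := hC.card_zeros hc h0
    (Finset.one_lt_card.2 ⟨i, mem_zeros.2 hi, j, mem_zeros.2 hj, hij⟩)
  refine ⟨zeros c, ⟨mem_zeroTriples.2 ⟨hcard, c, hc, h0, fun i hi => mem_zeros.1 hi⟩,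
    mem_zeros.2 hi, mem_zeros.2 hj⟩, ?_⟩
  rintro b ⟨hb, hib, hjb⟩
  obtain ⟨hb3, c', hc', h0', hz⟩ := mem_zeroTriples.1 hb
  obtain ⟨r, hr⟩ := hC.exists_smul hc hc' h0 hij hi hj (hz i hib) (hz j hjb)
  have h := hC.zeros_eq hc' h0' hb3 hz
  rw [← h]
  have hr0 : r ≠ 0 := by
    rintro rfl
    exact h0' (by rw [hr, zero_smul])
  ext l
  simp [mem_zeros, hr, hr0]

/-! ### The supports of the codewords of minimum weight -/

theorem HasThirdPoints.le_hammingNorm (hC : HasThirdPoints C) {c : ι → F} (hc : c ∈ C)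
    (h0 : c ≠ 0) : Fintype.card ι - 3 ≤ hammingNorm c := by
  have h1 := hC.card_zeros_le hc h0
  have h2 := hammingNorm_add_card_zeros c
  omega

theorem card_zeros_of_hammingNorm (hn : 4 ≤ Fintype.card ι) {c : ι → F}
    (hw : hammingNorm c = Fintype.card ι - 3) : (zeros c).card = 3 ∧ c ≠ 0 := by
  have h2 := hammingNorm_add_card_zeros c
  refine ⟨by omega, ?_⟩
  rintro rfl
  rw [hammingNorm_zero] at hw
  omega

theorem HasThirdPoints.supportsDetermine (hC : HasThirdPoints C) (hn : 4 ≤ Fintype.card ι) :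
    SupportsDetermine C (Fintype.card ι - 3) := by
  intro c hc c' hc' hw _ hs
  obtain ⟨hz, h0⟩ := card_zeros_of_hammingNorm hn hw
  obtain ⟨i, hi, j, hj, hij⟩ := Finset.one_lt_card.1 (by omega : 1 < (zeros c).card)
  have hzz : zeros c' = zeros c := by
    rw [← compl_inj_iff, compl_zeros, compl_zeros, hs]
  exact hC.exists_smul hc hc' h0 hij (mem_zeros.1 hi) (mem_zeros.1 hj)
    (mem_zeros.1 (hzz ▸ hi)) (mem_zeros.1 (hzz ▸ hj))

theorem HasThirdPoints.supportSet_eq (hC : HasThirdPoints C) (hn : 4 ≤ Fintype.card ι) :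
    supportSet C (Fintype.card ι - 3) = (zeroTriples C).image compl := by
  ext s
  rw [mem_supportSet, Finset.mem_image]
  constructor
  · rintro ⟨c, hc, hw, rfl⟩
    obtain ⟨hz, h0⟩ := card_zeros_of_hammingNorm hn hw
    exact ⟨zeros c, mem_zeroTriples.2 ⟨hz, c, hc, h0, fun i hi => mem_zeros.1 hi⟩, compl_zeros c⟩
  · rintro ⟨b, hb, rfl⟩
    obtain ⟨hb3, c, hc, h0, hz⟩ := mem_zeroTriples.1 hb
    have hzb := hC.zeros_eq hc h0 hb3 hz
    refine ⟨c, hc, ?_, by rw [← hzb, compl_zeros]⟩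
    have := hammingNorm_add_card_zeros c
    rw [hzb, hb3] at this
    omega

theorem HasThirdPoints.card_supportSet (hC : HasThirdPoints C) (hn : 4 ≤ Fintype.card ι) :
    (supportSet C (Fintype.card ι - 3)).card = (zeroTriples C).card := by
  rw [hC.supportSet_eq hn, Finset.card_image_of_injective _ compl_injective]

theorem HasThirdPoints.isSimpleDesign [Fintype F] (hC : HasThirdPoints C)
    (h3 : Module.finrank F C = 3) (hn : 5 ≤ Fintype.card ι) :
    IsSimpleDesign (blocks C (Fintype.card ι - 3)) 2 (Fintype.card ι) (Fintype.card ι - 3)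
      ((Fintype.card ι - 3) * (Fintype.card ι - 4) / 6) := by
  refine isSimpleDesign_blocks (by norm_num) (by omega) (by omega)
    (hC.supportsDetermine (by omega)) fun T hT => ?_
  obtain ⟨x, y, hxy, rfl⟩ := Finset.card_eq_two.1 hT
  rw [hC.supportSet_eq (by omega), Finset.filter_image,
    Finset.card_image_of_injective _ compl_injective,
    ← (hC.isTripleSystem h3).six_mul_card_filter_notMem hxy (by omega),
    Nat.mul_div_cancel_left _ (by norm_num)]
  congr 1
  ext b
  simp [Finset.insert_subset_iff]

theorem HasThirdPoints.exists_hammingNorm_eq (hC : HasThirdPoints C)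
    (h3 : Module.finrank F C = 3) (hn : 2 ≤ Fintype.card ι) :
    ∃ c ∈ C, c ≠ 0 ∧ hammingNorm c = Fintype.card ι - 3 := by
  obtain ⟨i, j, hij⟩ := Fintype.exists_pair_of_one_lt_card (by omega : 1 < Fintype.card ι)
  obtain ⟨c, hc, h0, hi, hj⟩ := exists_mem_ne_zero_of_two_coordinates h3 i j
  have h1 := hC.card_zeros hc h0
    (Finset.one_lt_card.2 ⟨i, mem_zeros.2 hi, j, mem_zeros.2 hj, hij⟩)
  have h2 := hammingNorm_add_card_zeros c
  exact ⟨c, hc, h0, by omega⟩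

/-! ### The codewords of weights three and four in the dual code -/

/-- A dual word vanishes at a point `k` if some codeword is nonzero at `k` but vanishes at the
other points of the support of the dual word. -/
theorem eq_zero_of_mem_dual {u c : ι → F} (hu : u ∈ dual C) (hc : c ∈ C) {k : ι} (hk : c k ≠ 0)
    (h : ∀ i, i ≠ k → u i = 0 ∨ c i = 0) : u k = 0 := by
  have h1 : u ⬝ᵥ c = 0 := hu c hc
  rw [dotProduct, Finset.sum_eq_single k] at h1
  · exact (mul_eq_zero.1 h1).resolve_right hk
  · intro i _ hik
    rcases h i hik with h | h <;> simp [h]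
  · simp

theorem HasThirdPoints.eq_zero_of_support_subset_pair (hC : HasThirdPoints C)
    (h3 : Module.finrank F C = 3) (hn : 4 ≤ Fintype.card ι) {u : ι → F} (hu : u ∈ dual C)
    {i j : ι} (hij : i ≠ j) (h : ∀ l, l ≠ i → l ≠ j → u l = 0) : u j = 0 := by
  obtain ⟨k, -, -, hk⟩ := hC i j hij
  obtain ⟨l, -, hl⟩ := Finset.exists_mem_notMem_of_card_lt_card
    (s := {i, j, k}) (t := (Finset.univ : Finset ι)) (by
      have : ({i, j, k} : Finset ι).card ≤ 3 := Finset.card_le_three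
      rw [Finset.card_univ]
      omega)
  simp only [Finset.mem_insert, Finset.mem_singleton, not_or] at hl
  obtain ⟨c, hc, h0, hi, hcl⟩ := exists_mem_ne_zero_of_two_coordinates h3 i l
  refine eq_zero_of_mem_dual hu hc
    (fun hj => h0 ((hk c hc hi hj).2 l hl.1 hl.2.1 hl.2.2 hcl)) fun a ha => ?_
  by_cases hai : a = i
  · exact Or.inr (hai ▸ hi)
  · exact Or.inl (h a hai ha)

theorem HasThirdPoints.three_le_hammingNorm (hC : HasThirdPoints C)
    (h3 : Module.finrank F C = 3) (hn : 4 ≤ Fintype.card ι) {u : ι → F} (hu : u ∈ dual C)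
    (h0 : u ≠ 0) : 3 ≤ hammingNorm u := by
  by_contra! hlt
  obtain ⟨s, hs, hs2⟩ := Finset.exists_superset_card_eq (s := support u) (n := 2)
    (by rw [card_support]; omega) (by omega)
  obtain ⟨i, j, hij, rfl⟩ := Finset.card_eq_two.1 hs2
  have h : ∀ l, l ≠ i → l ≠ j → u l = 0 := by
    intro l hli hlj
    by_contra hul
    have := hs (mem_support.2 hul)
    simp [hli, hlj] at this
  have hj := hC.eq_zero_of_support_subset_pair h3 hn hu hij h
  have hi := hC.eq_zero_of_support_subset_pair h3 hn hu hij.symm fun l h1 h2 => h l h2 h1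
  refine h0 (funext fun l => ?_)
  by_cases hli : l = i
  · exact hli ▸ hi
  by_cases hlj : l = j
  · exact hlj ▸ hj
  exact h l hli hlj

/-- Dual words supported in a set `S` exist if `S` has at least as many elements as the dimension
of the code, and if, in case of equality, some nonzero codeword vanishes on `S`. -/
theorem exists_mem_dual_support_subset {S : Finset ι}
    (hS : Module.finrank F C < S.card ∨
      Module.finrank F C = S.card ∧ ∃ c ∈ C, c ≠ 0 ∧ ∀ i ∈ S, c i = 0) :
    ∃ u ∈ dual C, u ≠ 0 ∧ support u ⊆ S := by
  let T : (ι → F) →ₗ[F] Module.Dual F C := LinearMap.mk₂ F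
    (fun (u : ι → F) (c : C) => u ⬝ᵥ (c : ι → F)) (fun _ _ _ => add_dotProduct _ _ _)
    (fun _ _ _ => smul_dotProduct _ _ _) (fun _ _ _ => dotProduct_add _ _ _)
    (fun _ _ _ => dotProduct_smul _ _ _)
  let R : (ι → F) →ₗ[F] ({i // i ∉ S} → F) := LinearMap.funLeft F F Subtype.val
  have hcard : Fintype.card {i // i ∉ S} + S.card = Fintype.card ι := by
    rw [Fintype.card_subtype_compl, Fintype.card_coe]
    exact Nat.sub_add_cancel (Finset.card_le_univ S)
  have hdim : Module.finrank F (Module.Dual F C × ({i // i ∉ S} → F)) =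
      Module.finrank F C + Fintype.card {i // i ∉ S} := by
    rw [Module.finrank_prod, Subspace.dual_finrank_eq, Module.finrank_fintype_fun_eq_card]
  have hker : LinearMap.ker (T.prod R) ≠ ⊥ := by
    rcases hS with hlt | ⟨heq, c, hc, h0, hz⟩
    · apply LinearMap.ker_ne_bot_of_finrank_lt
      rw [hdim, Module.finrank_fintype_fun_eq_card]
      omega
    · intro hbot
      have hsurj : Function.Surjective (T.prod R) :=
        (LinearMap.injective_iff_surjective_of_finrank_eq_finrank (by
          rw [hdim, Module.finrank_fintype_fun_eq_card]; omega)).1 (LinearMap.ker_eq_bot.1 hbot)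
      -- a functional on the code that is nonzero at `c` is not the product with a word
      -- supported in `S`
      have hc0 : (⟨c, hc⟩ : C) ≠ 0 := fun h => h0 (congrArg Subtype.val h)
      obtain ⟨φ, hφ⟩ : ∃ φ : Module.Dual F C, φ ⟨c, hc⟩ ≠ 0 := by
        by_contra! hcon
        exact hc0 ((Module.forall_dual_apply_eq_zero_iff F _).1 hcon)
      obtain ⟨u, hu⟩ := hsurj (φ, 0)
      have hu1 : T u = φ := congrArg Prod.fst hu
      have hu2 : R u = 0 := congrArg Prod.snd hu
      refine hφ ?_
      rw [← hu1]
      refine Finset.sum_eq_zero fun i _ => ?_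
      by_cases hi : i ∈ S
      · exact mul_eq_zero_of_right _ (hz i hi)
      · exact mul_eq_zero_of_left (congrFun hu2 ⟨i, hi⟩) _
  obtain ⟨u, hu, hu0⟩ := Submodule.exists_mem_ne_zero_of_ne_bot hker
  have hu1 : T u = 0 := congrArg Prod.fst (LinearMap.mem_ker.1 hu)
  have hu2 : R u = 0 := congrArg Prod.snd (LinearMap.mem_ker.1 hu)
  refine ⟨u, fun c hc => LinearMap.congr_fun hu1 ⟨c, hc⟩, hu0, fun i hi => ?_⟩
  by_contra hiS
  exact mem_support.1 hi (congrFun hu2 ⟨i, hiS⟩)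

/-- The supports of the dual words of weight three are the zero sets of the codewords of minimum
weight. -/
theorem support_mem_zeroTriples (h3 : Module.finrank F C = 3) {u : ι → F} (hu : u ∈ dual C)
    (hw : hammingNorm u = 3) :
    support u ∈ zeroTriples C := by
  rw [mem_zeroTriples]
  refine ⟨hw, ?_⟩
  obtain ⟨i, j, k, hij, hik, hjk, hs⟩ := Finset.card_eq_three.1 hw
  have hs' : support u = {i, j, k} := hs
  obtain ⟨c, hc, h0, hi, hj⟩ := exists_mem_ne_zero_of_two_coordinates h3 i j
  refine ⟨c, hc, h0, ?_⟩
  have hk : c k = 0 := by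
    by_contra hk
    have huk : u k ≠ 0 := mem_support.1 (hs' ▸ by simp)
    refine huk (eq_zero_of_mem_dual hu hc hk fun l hl => ?_)
    by_cases hul : u l = 0
    · exact Or.inl hul
    · have : l ∈ ({i, j, k} : Finset ι) := hs' ▸ mem_support.2 hul
      simp only [Finset.mem_insert, Finset.mem_singleton] at this
      rcases this with rfl | rfl | rfl
      · exact Or.inr hi
      · exact Or.inr hj
      · exact absurd rfl hl
  rw [hs']
  intro l hl
  simp only [Finset.mem_insert, Finset.mem_singleton] at hl
  rcases hl with rfl | rfl | rfl <;> assumption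

theorem HasThirdPoints.supportSet_dual_three (hC : HasThirdPoints C)
    (h3 : Module.finrank F C = 3) (hn : 4 ≤ Fintype.card ι) :
    supportSet (dual C) 3 = zeroTriples C := by
  ext b
  rw [mem_supportSet]
  constructor
  · rintro ⟨u, hu, hw, rfl⟩
    exact support_mem_zeroTriples h3 hu hw
  · intro hb
    obtain ⟨hb3, hc⟩ := mem_zeroTriples.1 hb
    obtain ⟨u, hu, h0, hs⟩ := exists_mem_dual_support_subset (S := b) (Or.inr ⟨by omega, hc⟩)
    have hw := hC.three_le_hammingNorm h3 hn hu h0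
    rw [← card_support] at hw
    have hsb : support u = b := Finset.eq_of_subset_of_card_le hs (by omega)
    exact ⟨u, hu, by rw [← card_support, hsb, hb3], hsb⟩

/-- Two words with a common support of `w` elements are proportional if no nonzero word has its
support strictly inside, because some combination of the two has a smaller support. -/
theorem exists_smul_of_support_eq {D : Submodule F (ι → F)} {u u' : ι → F} (hu : u ∈ D)
    (hu' : u' ∈ D) (h0 : u ≠ 0) (hs : support u = support u')
    (hD : ∀ v ∈ D, support v ⊂ support u → v = 0) : ∃ r : F, u' = r • u := by
  obtain ⟨i, hi⟩ := Function.ne_iff.1 h0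
  have hi : u i ≠ 0 := hi
  have hv := hD (u i • u' - u' i • u) (D.sub_mem (D.smul_mem _ hu') (D.smul_mem _ hu)) (by
    rw [Finset.ssubset_iff_of_subset]
    · exact ⟨i, mem_support.2 hi, fun h => mem_support.1 h (by simp [mul_comm])⟩
    · intro l hl
      by_contra hul
      have h1 : u l = 0 := by simpa [mem_support] using hul
      rw [hs] at hul
      have h2 : u' l = 0 := by simpa [mem_support] using hul
      exact mem_support.1 hl (by simp [h1, h2]))
  refine ⟨(u i)⁻¹ * u' i, ?_⟩
  rw [mul_smul, ← sub_eq_zero.1 hv, smul_smul, inv_mul_cancel₀ hi, one_smul]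

theorem HasThirdPoints.supportsDetermine_dual_three (hC : HasThirdPoints C)
    (h3 : Module.finrank F C = 3) (hn : 4 ≤ Fintype.card ι) : SupportsDetermine (dual C) 3 := by
  intro u hu u' hu' hw _ hs
  have h0 : u ≠ 0 := by
    rintro rfl
    simp at hw
  refine exists_smul_of_support_eq hu hu' h0 hs fun v hv hlt => ?_
  by_contra hv0
  have h1 := hC.three_le_hammingNorm h3 hn hv hv0
  have h2 := Finset.card_lt_card hlt
  rw [card_support, card_support] at h2
  omega

theorem HasThirdPoints.isSimpleDesign_dual_three [Fintype F] (hC : HasThirdPoints C)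
    (h3 : Module.finrank F C = 3) (hn : 4 ≤ Fintype.card ι) :
    IsSimpleDesign (blocks (dual C) 3) 2 (Fintype.card ι) 3 1 := by
  refine isSimpleDesign_blocks (by norm_num) (by norm_num) (by omega)
    (hC.supportsDetermine_dual_three h3 hn) fun T hT => ?_
  obtain ⟨x, y, hxy, rfl⟩ := Finset.card_eq_two.1 hT
  rw [hC.supportSet_dual_three h3 hn, ← (hC.isTripleSystem h3).card_filter_mem_mem hxy]
  congr 1
  ext b
  simp [Finset.insert_subset_iff]

/-- A set of four points that supports a dual word contains no triple on a line: a nonzero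
codeword vanishing on the triple would not vanish at the fourth point. -/
theorem HasThirdPoints.not_subset_support (hC : HasThirdPoints C) {u : ι → F} (hu : u ∈ dual C)
    (hw : hammingNorm u = 4) {b : Finset ι} (hb : b ∈ zeroTriples C) : ¬ b ⊆ support u := by
  intro hbu
  obtain ⟨hb3, c, hc, h0, hz⟩ := mem_zeroTriples.1 hb
  have hzb := hC.zeros_eq hc h0 hb3 hz
  have h1 : (support u \ b).card = 1 := by
    rw [Finset.card_sdiff_of_subset hbu, card_support, hw, hb3]
  obtain ⟨l, hl⟩ := Finset.card_eq_one.1 h1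
  have hl' : l ∈ support u \ b := by simp [hl]
  rw [Finset.mem_sdiff, mem_support] at hl'
  refine hl'.1 (eq_zero_of_mem_dual hu hc (fun h => hl'.2 (hzb ▸ mem_zeros.2 h)) fun a ha => ?_)
  by_contra! hcon
  have : a ∈ support u \ b :=
    Finset.mem_sdiff.2 ⟨mem_support.2 hcon.1, fun hab => hcon.2 (hz a hab)⟩
  rw [hl, Finset.mem_singleton] at this
  exact ha this

theorem HasThirdPoints.mem_supportSet_dual_four (hC : HasThirdPoints C)
    (h3 : Module.finrank F C = 3) (hn : 4 ≤ Fintype.card ι) {S : Finset ι} :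
    S ∈ supportSet (dual C) 4 ↔ S.card = 4 ∧ ∀ b ∈ zeroTriples C, ¬ b ⊆ S := by
  rw [mem_supportSet]
  constructor
  · rintro ⟨u, hu, hw, rfl⟩
    exact ⟨hw, fun b hb => hC.not_subset_support hu hw hb⟩
  · rintro ⟨hS4, hS⟩
    obtain ⟨u, hu, h0, hs⟩ := exists_mem_dual_support_subset (C := C) (S := S) (Or.inl (by omega))
    have h1 := hC.three_le_hammingNorm h3 hn hu h0
    have h2 : hammingNorm u ≠ 3 := fun h => hS _ (support_mem_zeroTriples h3 hu h) hs
    rw [← card_support] at h1 h2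
    have hsS : support u = S := Finset.eq_of_subset_of_card_le hs (by omega)
    exact ⟨u, hu, by rw [← card_support, hsS, hS4], hsS⟩

theorem HasThirdPoints.supportsDetermine_dual_four (hC : HasThirdPoints C)
    (h3 : Module.finrank F C = 3) (hn : 4 ≤ Fintype.card ι) : SupportsDetermine (dual C) 4 := by
  intro u hu u' hu' hw _ hs
  have h0 : u ≠ 0 := by
    rintro rfl
    simp at hw
  refine exists_smul_of_support_eq hu hu' h0 hs fun v hv hlt => ?_
  by_contra hv0
  have h1 := hC.three_le_hammingNorm h3 hn hv hv0
  have h2 := Finset.card_lt_card hlt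
  rw [card_support, card_support] at h2
  exact hC.not_subset_support hu hw (support_mem_zeroTriples h3 hv (by omega)) hlt.subset

theorem HasThirdPoints.isSimpleDesign_dual_four [Fintype F] (hC : HasThirdPoints C)
    (h3 : Module.finrank F C = 3) (hn : 4 ≤ Fintype.card ι) :
    IsSimpleDesign (blocks (dual C) 4) 2 (Fintype.card ι) 4
      ((Fintype.card ι - 3) * (Fintype.card ι - 6) / 2) := by
  refine isSimpleDesign_blocks (by norm_num) (by norm_num) hn
    (hC.supportsDetermine_dual_four h3 hn) fun T hT => ?_
  obtain ⟨x, y, hxy, rfl⟩ := Finset.card_eq_two.1 hT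
  rw [← (hC.isTripleSystem h3).two_mul_card_four_sets hxy,
    Nat.mul_div_cancel_left _ (by norm_num)]
  congr 1
  ext S
  simp [Finset.insert_subset_iff, hC.mem_supportSet_dual_four h3 hn]

end ThirdPoint

/-! ### The weight enumerator -/

section WeightEnumerator

variable {ι F : Type*} [Fintype ι] [DecidableEq ι] [Field F] [Fintype F] [DecidableEq F]

/-- The codewords of `C` as a finset. -/
noncomputable def words (C : Submodule F (ι → F)) : Finset (ι → F) :=
  (Set.toFinite (C : Set (ι → F))).toFinset

variable {C : Submodule F (ι → F)}

theorem mem_words {c : ι → F} : c ∈ words C ↔ c ∈ C := by simp [words]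

theorem numWords_eq_card_filter (w : ℕ) :
    numWords C w = ((words C).filter fun c => hammingNorm c = w).card := by
  rw [numWords, ← Set.ncard_coe_finset]
  congr 1
  ext c
  simp [mem_words]

theorem card_words (C : Submodule F (ι → F)) :
    (words C).card = Fintype.card F ^ Module.finrank F C := by
  rw [words, ← Set.ncard_eq_toFinset_card, ← Nat.card_coe_set_eq, ← Nat.card_eq_fintype_card]
  exact Module.natCard_eq_pow_finrank

theorem sum_numWords (C : Submodule F (ι → F)) :
    ∑ w ∈ Finset.range (Fintype.card ι + 1), numWords C w =
      Fintype.card F ^ Module.finrank F C := by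
  rw [← card_words, Finset.card_eq_sum_card_fiberwise (f := hammingNorm)
    (t := Finset.range (Fintype.card ι + 1))
    fun c _ => Finset.mem_coe.2 (Finset.mem_range.2
      (Nat.lt_succ_of_le hammingNorm_le_card_fintype))]
  exact Finset.sum_congr rfl fun w _ => numWords_eq_card_filter w

theorem card_words_filter_eq_zero {i : ι} (hi : ∃ c ∈ C, c i ≠ 0) :
    Fintype.card F * ((words C).filter fun c => c i = 0).card =
      Fintype.card F ^ Module.finrank F C := by
  obtain ⟨c, hc, hci⟩ := hi
  let f : C →ₗ[F] F := (LinearMap.proj i).comp C.subtype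
  have hf : f ≠ 0 := fun h => hci (LinearMap.congr_fun h ⟨c, hc⟩)
  have hr := Module.Dual.finrank_ker_add_one_of_ne_zero (f := f) hf
  have hcard : ((words C).filter fun c => c i = 0).card =
      Fintype.card F ^ Module.finrank F (LinearMap.ker f) := by
    rw [← Nat.card_eq_fintype_card,
      ← Module.natCard_eq_pow_finrank (K := F) (V := LinearMap.ker f), ← Nat.card_eq_finsetCard]
    refine Nat.card_congr ⟨fun c => ⟨⟨c.1, mem_words.1 (Finset.mem_filter.1 c.2).1⟩,
      (Finset.mem_filter.1 c.2).2⟩, fun c => ⟨c.1.1, Finset.mem_filter.2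
        ⟨mem_words.2 c.1.2, c.2⟩⟩, fun c => rfl, fun c => rfl⟩
  rw [hcard, ← hr, pow_succ, mul_comm]

/-- The total number of zero coordinates of all codewords, counted by weights and by
coordinates. -/
theorem sum_mul_numWords (h : ∀ i, ∃ c ∈ C, c i ≠ 0) :
    Fintype.card F * ∑ w ∈ Finset.range (Fintype.card ι + 1), (Fintype.card ι - w) * numWords C w =
      Fintype.card ι * Fintype.card F ^ Module.finrank F C := by
  have h1 : ∑ w ∈ Finset.range (Fintype.card ι + 1), (Fintype.card ι - w) * numWords C w =
      ∑ c ∈ words C, (zeros c).card := by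
    rw [← Finset.sum_fiberwise_of_maps_to (g := hammingNorm)
      (t := Finset.range (Fintype.card ι + 1))
      fun c _ => Finset.mem_range.2 (Nat.lt_succ_of_le hammingNorm_le_card_fintype)]
    refine Finset.sum_congr rfl fun w _ => ?_
    rw [numWords_eq_card_filter, mul_comm, ← smul_eq_mul, ← Finset.sum_const]
    refine Finset.sum_congr rfl fun c hc => ?_
    have := hammingNorm_add_card_zeros c
    rw [← (Finset.mem_filter.1 hc).2]
    omega
  have h2 := Finset.sum_card_bipartiteAbove_eq_sum_card_bipartiteBelow
    (s := words C) (t := Finset.univ) (fun c i => c i = 0)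
  have h3 : ∑ c ∈ words C, (zeros c).card =
      ∑ i : ι, ((words C).filter fun c => c i = 0).card := h2
  rw [h1, h3, Finset.mul_sum, Finset.sum_congr rfl fun i _ => card_words_filter_eq_zero (h i),
    Finset.sum_const, smul_eq_mul, Finset.card_univ]

theorem numWords_zero (C : Submodule F (ι → F)) : numWords C 0 = 1 := by
  rw [numWords, Set.ncard_eq_one]
  refine ⟨0, ?_⟩
  ext c
  simp only [hammingNorm_eq_zero, Set.mem_ofPred_eq, Set.mem_singleton_iff]
  exact ⟨fun h => h.2, fun h => ⟨h ▸ C.zero_mem, h⟩⟩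

theorem HasThirdPoints.numWords_eq_zero (hC : HasThirdPoints C) {w : ℕ} (h0 : w ≠ 0)
    (h1 : w ≠ Fintype.card ι - 3) (h2 : w ≠ Fintype.card ι - 1) (h3 : w ≠ Fintype.card ι) :
    numWords C w = 0 := by
  rw [numWords_eq_card_filter, Finset.card_eq_zero, Finset.filter_eq_empty_iff]
  intro c hc hw
  have hc0 : c ≠ 0 := by
    rintro rfl
    rw [hammingNorm_zero] at hw
    exact h0 hw.symm
  have h4 := hammingNorm_add_card_zeros c
  have h5 := hC.card_zeros (mem_words.1 hc) hc0
  omega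

theorem HasThirdPoints.exists_ne_zero (hC : HasThirdPoints C) (h3 : Module.finrank F C = 3)
    (hn : 4 ≤ Fintype.card ι) (i : ι) : ∃ c ∈ C, c i ≠ 0 := by
  by_contra! h
  obtain ⟨j, hj⟩ := Fintype.exists_ne_of_one_lt_card (by omega : 1 < Fintype.card ι) i
  -- the unit vector at `i` would be a dual word of weight one
  have hu : (Pi.single i 1 : ι → F) ∈ dual C := fun c hc => by
    rw [single_dotProduct, h c hc, mul_zero]
  have := hC.eq_zero_of_support_subset_pair h3 hn hu hj fun l _ hl => Pi.single_eq_of_ne hl 1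
  simp at this

theorem sum_range_eq_of_eq_zero {R : Type*} [AddCommMonoid R]
    (hn : 4 ≤ Fintype.card ι) (f : ℕ → R)
    (hf : ∀ w, w ≠ 0 → w ≠ Fintype.card ι - 3 → w ≠ Fintype.card ι - 1 → w ≠ Fintype.card ι →
      f w = 0) :
    ∑ w ∈ Finset.range (Fintype.card ι + 1), f w =
      f 0 + (f (Fintype.card ι - 3) + (f (Fintype.card ι - 1) + f (Fintype.card ι))) := by
  have h : ∑ w ∈ ({0, Fintype.card ι - 3, Fintype.card ι - 1, Fintype.card ι} : Finset ℕ), f w =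
      ∑ w ∈ Finset.range (Fintype.card ι + 1), f w := by
    refine Finset.sum_subset (fun w hw => ?_) fun w _ hw => ?_
    · simp only [Finset.mem_insert, Finset.mem_singleton] at hw
      rw [Finset.mem_range]
      omega
    · simp only [Finset.mem_insert, Finset.mem_singleton, not_or] at hw
      exact hf w hw.1 hw.2.1 hw.2.2.1 hw.2.2.2
  rw [← h, Finset.sum_insert (by simp; omega), Finset.sum_insert (by simp; omega),
    Finset.sum_insert (by simp; omega), Finset.sum_singleton]

/-- The weight distribution follows from the number of triples of zeros, from the number of
codewords, and from the total number of zeros. -/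
theorem HasThirdPoints.weightEnumerator_eq (hC : HasThirdPoints C)
    (h3 : Module.finrank F C = 3) {q : ℕ} (hq : Fintype.card F = q)
    (hι : Fintype.card ι = q - 1) (hq5 : 5 ≤ q) :
    weightEnumerator C =
      1 + Polynomial.C (((q : ℚ) - 1) ^ 2 * ((q : ℚ) - 2) / 6) * X ^ (q - 4)
        + Polynomial.C (((q : ℚ) - 1) ^ 2 * ((q : ℚ) + 4) / 2) * X ^ (q - 2)
        + Polynomial.C (((q : ℚ) - 1) * ((q : ℚ) ^ 2 + 8) / 3) * X ^ (q - 1) := by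
  have hn : 4 ≤ Fintype.card ι := by omega
  have hz := fun w => hC.numWords_eq_zero (w := w)
  have e1 := numWords_eq (by omega) (hC.supportsDetermine hn)
  rw [hC.card_supportSet hn, hq] at e1
  have e2 := (hC.isTripleSystem h3).six_mul_card
  have e3 := sum_numWords C
  rw [sum_range_eq_of_eq_zero hn _ hz, numWords_zero, h3, hq] at e3
  have e4 := sum_mul_numWords (hC.exists_ne_zero h3 hn)
  rw [sum_range_eq_of_eq_zero hn _ fun w h1 h2 h3 h4 => by rw [hz w h1 h2 h3 h4, mul_zero],
    numWords_zero, h3, hq, hι] at e4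
  have hp : weightEnumerator C = 1 + Polynomial.C (numWords C (q - 4) : ℚ) * X ^ (q - 4)
        + Polynomial.C (numWords C (q - 2) : ℚ) * X ^ (q - 2)
        + Polynomial.C (numWords C (q - 1) : ℚ) * X ^ (q - 1) := by
    rw [weightEnumerator, sum_range_eq_of_eq_zero hn _ fun w h1 h2 h3 h4 => by
      rw [hz w h1 h2 h3 h4]; simp, numWords_zero, hι,
      (by omega : q - 1 - 3 = q - 4), (by omega : q - 1 - 1 = q - 2), Nat.cast_one, map_one,
      pow_zero, mul_one]
    simp only [add_assoc]
  rw [hι] at e1 e2 e3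
  obtain ⟨k, rfl⟩ := Nat.exists_eq_add_of_le hq5
  have a1 : 5 + k - 1 = k + 4 := by omega
  have a2 : k + 4 - 3 = k + 1 := by omega
  have a3 : k + 4 - 1 = k + 3 := by omega
  have a4 : 5 + k - 4 = k + 1 := by omega
  have a5 : 5 + k - 2 = k + 3 := by omega
  have a6 : k + 4 - (k + 1) = 3 := by omega
  have a7 : k + 4 - (k + 3) = 1 := by omega
  rw [hp]
  simp only [a1, a2, a3, a4, a5, a6, a7, Nat.sub_zero, Nat.sub_self, zero_mul, add_zero, one_mul,
    mul_one] at e1 e2 e3 e4 ⊢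
  have q1 : (numWords C (k + 1) : ℚ) = (k + 4) * (zeroTriples C).card := by exact_mod_cast e1
  have q2 : (6 : ℚ) * (zeroTriples C).card = (k + 4) * (k + 3) := by exact_mod_cast e2
  have q3 : (1 : ℚ) + (numWords C (k + 1) + (numWords C (k + 3) + numWords C (k + 4))) =
    (5 + k) ^ 3 := by exact_mod_cast e3
  have q4 : ((5 : ℚ) + k) * ((k + 4) + (3 * numWords C (k + 1) + numWords C (k + 3))) =
    (k + 4) * (5 + k) ^ 3 := by exact_mod_cast e4
  have hk : (5 : ℚ) + k ≠ 0 := by positivity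
  have q5 : ((k : ℚ) + 4) + (3 * numWords C (k + 1) + numWords C (k + 3)) =
    (k + 4) * (5 + k) ^ 2 := by
    apply mul_left_cancel₀ hk
    rw [q4]; ring
  have r1 : (numWords C (k + 1) : ℚ) =
      (((5 + k : ℕ) : ℚ) - 1) ^ 2 * (((5 + k : ℕ) : ℚ) - 2) / 6 := by
    push_cast
    rw [q1]
    linear_combination ((k : ℚ) + 4) / 6 * q2
  have r2 : (numWords C (k + 3) : ℚ) =
      (((5 + k : ℕ) : ℚ) - 1) ^ 2 * (((5 + k : ℕ) : ℚ) + 4) / 2 := by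
    push_cast at r1 ⊢
    linear_combination q5 - 3 * r1
  have r3 : (numWords C (k + 4) : ℚ) =
      (((5 + k : ℕ) : ℚ) - 1) * (((5 + k : ℕ) : ℚ) ^ 2 + 8) / 3 := by
    push_cast at r1 r2 ⊢
    linear_combination q3 - r1 - r2
  rw [r1, r2, r3]

end WeightEnumerator

/-! ### The third point of a line through two points `(1, x, x * σ x)` -/

section Field

variable {F : Type*} [Field F]

theorem eq_zero_or_one_of_pow_eq [Fintype F] {m h : ℕ} (hmh : Nat.gcd m h = 1)
    (hF : Fintype.card F = 2 ^ m) {s : F} (hs : s ^ 2 ^ h = s) (hs0 : s ≠ 0) : s = 1 := by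
  have key : ∀ k : ℕ, s ^ 2 ^ k = s → s ^ (2 ^ k - 1) = 1 := by
    intro k hk
    apply mul_right_cancel₀ hs0
    rw [← pow_succ, Nat.sub_add_cancel Nat.one_le_two_pow, hk, one_mul]
  have h1 := orderOf_dvd_of_pow_eq_one (key h hs)
  have h2 := orderOf_dvd_of_pow_eq_one (key m (hF ▸ FiniteField.pow_card s))
  have h3 := Nat.dvd_gcd h2 h1
  rw [Nat.pow_sub_one_gcd_pow_sub_one, hmh] at h3
  exact orderOf_eq_one_iff.1 (Nat.dvd_one.1 (by simpa using h3))

variable {σ : F →+* F}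

/-- If only `0` and `1` are fixed by `σ`, the homomorphism `s ↦ σ s / s` of the group of units is
injective, and hence surjective. -/
theorem exists_mul_eq_mul_map [Finite F] (hσ : ∀ s, σ s = s → s ≠ 0 → s = 1) {x y : F}
    (hx : x ≠ 0) (hy : y ≠ 0) : ∃ r, r ≠ 0 ∧ x * r = y * σ r := by
  let f : Fˣ →* Fˣ := Units.map (σ : F →* F) / MonoidHom.id Fˣ
  have hf : Function.Injective f := by
    rw [injective_iff_map_eq_one]
    intro s hs
    have h1 : Units.map (σ : F →* F) s = s := div_eq_one.1 hs
    exact Units.ext (hσ s (congrArg Units.val h1) s.ne_zero)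
  obtain ⟨r, hr⟩ := Finite.surjective_of_injective hf (Units.mk0 x hx / Units.mk0 y hy)
  have hr' : Units.map (σ : F →* F) r / r = Units.mk0 x hx / Units.mk0 y hy := hr
  rw [div_eq_div_iff_mul_eq_mul] at hr'
  have h1 := congrArg Units.val hr'
  simp only [Units.val_mul, Units.coe_map, Units.val_mk0, MonoidHom.coe_coe] at h1
  exact ⟨r, r.ne_zero, by rw [← h1, mul_comm]⟩

/-- In characteristic two, the line through the points `(1, x, x * σ x)` and `(1, y, y * σ y)`,
with `x` and `y` nonzero, contains exactly one further point of this form, and it is not the one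
with parameter zero. The points of the line with first coordinate one, other than the first
point, are `((1, y, y * σ y) + r • (1, x, x * σ x)) / (1 + r)` for `r ≠ 1`, and for `r ≠ 0` such
a point is of the form `(1, z, z * σ z)` if and only if `x * r = y * σ r`. -/
theorem exists_third_root [CharP F 2] [Finite F] (hσ : ∀ s, σ s = s → s ≠ 0 → s = 1) {x y : F}
    (hx : x ≠ 0) (hy : y ≠ 0) (hxy : x ≠ y) :
    ∃ z, z ≠ 0 ∧ z ≠ x ∧ z ≠ y ∧ ∀ a b d : F, a + b * x + d * (x * σ x) = 0 →
      a + b * y + d * (y * σ y) = 0 → a + b * z + d * (z * σ z) = 0 ∧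
      ∀ w, w ≠ x → w ≠ y → w ≠ z → a + b * w + d * (w * σ w) = 0 → a = 0 ∧ b = 0 ∧ d = 0 := by
  have h2 : (2 : F) = 0 := CharTwo.two_eq_zero
  have ne1 : ∀ s : F, s ≠ 1 → 1 + s ≠ 0 := fun s hs h => hs (CharTwo.add_eq_zero.1 h).symm
  obtain ⟨r, hr0, hr⟩ := exists_mul_eq_mul_map hσ hx hy
  have hr1 : r ≠ 1 := by
    rintro rfl
    rw [map_one, mul_one, mul_one] at hr
    exact hxy hr
  have hσr1 : σ r ≠ 1 := fun h => hr1 (σ.injective (by rw [h, map_one]))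
  have hd := ne1 r hr1
  have hσd := ne1 _ hσr1
  obtain ⟨z, hz⟩ : ∃ z, z = (y + x * r) / (1 + r) := ⟨_, rfl⟩
  have hz1 : z * (1 + r) = y + x * r := by rw [hz, div_mul_cancel₀ _ hd]
  have hσz1 : σ z * (1 + σ r) = σ y + σ x * σ r := by
    rw [← map_one σ, ← map_add, ← map_mul, hz1, map_add, map_mul]
  have hz2 : z * σ z * (1 + r) = y * σ y + x * σ x * r := by
    apply mul_right_cancel₀ hσd
    linear_combination (z * (1 + r)) * hσz1 + (σ y + σ x * σ r) * hz1 +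
      (σ y - σ x) * hr
  refine ⟨z, ?_, ?_, ?_, fun a b d h1 h3 => ⟨?_, ?_⟩⟩
  · rintro rfl
    have : y * (1 + σ r) = 0 := by linear_combination -hz1 - hr
    exact (mul_ne_zero hy hσd) this
  · rintro rfl
    exact hxy (by linear_combination hz1)
  · rintro rfl
    exact hxy (mul_right_cancel₀ hr0 (by linear_combination -hz1))
  · apply mul_right_cancel₀ hd
    linear_combination h3 + r * h1 + b * hz1 + d * hz2
  · intro w hwx hwy hwz h4
    have hsub : ∀ s t : F, s ≠ t → s + t ≠ 0 := fun s t hst h => hst (CharTwo.add_eq_zero.1 h)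
    have hd0 : d = 0 := by
      by_contra hd0
      -- `w` is the point with parameter `p`
      obtain ⟨p, hp⟩ : ∃ p, p = (w + y) / (w + x) := ⟨_, rfl⟩
      have hp1 : p * (w + x) = w + y := by rw [hp, div_mul_cancel₀ _ (hsub _ _ hwx)]
      have hp0 : p ≠ 0 := by rw [hp]; exact div_ne_zero (hsub _ _ hwy) (hsub _ _ hwx)
      have hw1 : w * (1 + p) = y + x * p := by linear_combination hp1 + (w - x * p) * h2
      have hσw1 : σ w * (1 + σ p) = σ y + σ x * σ p := by
        rw [← map_one σ, ← map_add, ← map_mul, hw1, map_add, map_mul]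
      have hw2 : w * σ w * (1 + p) = y * σ y + x * σ x * p := by
        apply mul_left_cancel₀ hd0
        linear_combination (1 + p) * h4 - h3 - p * h1 - b * hw1
      have hpp : x * p = y * σ p := by
        apply mul_right_cancel₀ (sub_ne_zero.2 fun h => hxy (σ.injective h) : σ x - σ y ≠ 0)
        linear_combination (σ w * (1 + σ p)) * hw1 + (y + x * p) * hσw1 - (1 + σ p) * hw2
      have hq : p / r = 1 := by
        refine hσ _ ?_ (div_ne_zero hp0 hr0)
        have hσr0 : σ r ≠ 0 := (map_ne_zero σ).2 hr0
        rw [map_div₀, div_eq_div_iff hσr0 hr0]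
        apply mul_left_cancel₀ hy
        linear_combination -r * hpp + p * hr
      have hpr : p = r := (div_eq_one_iff_eq hr0).1 hq
      refine hwz (mul_right_cancel₀ hd ?_)
      rw [hz1, ← hpr, hw1]
    subst hd0
    have hb0 : b = 0 := by
      refine (mul_eq_zero.1 (?_ : b * (x - y) = 0)).resolve_right (sub_ne_zero.2 hxy)
      linear_combination h1 - h3
    subst hb0
    exact ⟨by linear_combination h1, rfl, rfl⟩

end Field

/-! ### Codes spanned by the rows of a matrix, and `codeD` -/

section Code

variable {ι F : Type*} [Fintype ι] [Field F] [DecidableEq F]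

theorem mem_span_row {k : ℕ} {M : Matrix (Fin k) ι F} {c : ι → F} :
    c ∈ Submodule.span F (Set.range M.row) ↔ ∃ a, Matrix.vecMul a M = c := by
  rw [← range_vecMulLinear]
  rfl

theorem finrank_dual_span_row [DecidableEq ι] {k : ℕ} (M : Matrix (Fin k) ι F) :
    Module.finrank F (Submodule.span F (Set.range M.row)) +
      Module.finrank F (dual (Submodule.span F (Set.range M.row))) = Fintype.card ι := by
  have h : dual (Submodule.span F (Set.range M.row)) = LinearMap.ker M.mulVecLin := by
    ext u
    rw [LinearMap.mem_ker, Matrix.mulVecLin_apply]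
    constructor
    · intro hu
      ext i
      have := hu (M.row i) (Submodule.subset_span ⟨i, rfl⟩)
      rw [dotProduct_comm] at this
      exact this
    · intro hu c hc
      obtain ⟨a, rfl⟩ := mem_span_row.1 hc
      rw [dotProduct_comm, ← Matrix.dotProduct_mulVec, hu, dotProduct_zero]
  rw [h, ← Matrix.rank_eq_finrank_span_row, Matrix.rank, LinearMap.finrank_range_add_finrank_ker,
    Module.finrank_fintype_fun_eq_card]

theorem isLinearCode_dual [DecidableEq ι] [Fintype F] {C : Submodule F (ι → F)}
    (hC : HasThirdPoints C)
    (h3 : Module.finrank F C = 3) (hn : 4 ≤ Fintype.card ι)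
    (hd : Module.finrank F (dual C) = Fintype.card ι - 3) :
    IsLinearCode (dual C) (Fintype.card ι) (Fintype.card ι - 3) 3 := by
  refine ⟨rfl, hd, isLeast_hammingDist ?_ fun u hu h0 => hC.three_le_hammingNorm h3 hn hu h0⟩
  obtain ⟨i, j, hij⟩ := Fintype.exists_pair_of_one_lt_card (by omega : 1 < Fintype.card ι)
  obtain ⟨b, ⟨hb, -⟩, -⟩ := (hC.isTripleSystem h3).2 i j hij
  rw [← hC.supportSet_dual_three h3 hn, mem_supportSet] at hb
  obtain ⟨u, hu, hw, -⟩ := hb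
  refine ⟨u, hu, ?_, hw⟩
  rintro rfl
  simp at hw

theorem isLinearCode_of_hasThirdPoints [DecidableEq ι] {C : Submodule F (ι → F)}
    (hC : HasThirdPoints C) (h3 : Module.finrank F C = 3) (hn : 2 ≤ Fintype.card ι) :
    IsLinearCode C (Fintype.card ι) 3 (Fintype.card ι - 3) :=
  ⟨rfl, h3, isLeast_hammingDist (hC.exists_hammingNorm_eq h3 hn)
    fun _ hc h0 => hC.le_hammingNorm hc h0⟩

theorem vecMul_matrixD {α : Fˣ} {h q : ℕ} (a : Fin 3 → F) (i : Fin (q - 1)) :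
    Matrix.vecMul a (matrixD α h q) i =
      a 0 + a 1 * (α : F) ^ (i.val + 1) + a 2 * ((α : F) ^ (i.val + 1)) ^ (2 ^ h + 1) := by
  simp [Matrix.vecMul, dotProduct, Fin.sum_univ_three, matrixD]

theorem mem_codeD {α : Fˣ} {h q : ℕ} {c : Fin (q - 1) → F} :
    c ∈ codeD α h q ↔ ∃ a b d : F, ∀ i : Fin (q - 1),
      c i = a + b * (α : F) ^ (i.val + 1) + d * ((α : F) ^ (i.val + 1)) ^ (2 ^ h + 1) := by
  rw [codeD, mem_span_row]
  constructor
  · rintro ⟨a, rfl⟩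
    exact ⟨a 0, a 1, a 2, fun i => vecMul_matrixD a i⟩
  · rintro ⟨a, b, d, hc⟩
    exact ⟨![a, b, d], funext fun i => by rw [hc, vecMul_matrixD]; rfl⟩

variable [Fintype F] {α : Fˣ} {q : ℕ}

theorem pow_succ_injective (hF : Fintype.card F = q) (hα : ∀ x : Fˣ, x ∈ Subgroup.zpowers α) :
    Function.Injective fun i : Fin (q - 1) => (α : F) ^ (i.val + 1) := by
  have ho : orderOf α = q - 1 := by
    rw [orderOf_eq_card_of_forall_mem_zpowers hα, Nat.card_eq_fintype_card, Fintype.card_units, hF]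
  intro i j hij
  have h1 : α ^ (i.val + 1) = α ^ (j.val + 1) := Units.ext (by simpa using hij)
  have h2 : α ^ i.val = α ^ j.val := by
    rw [pow_succ, pow_succ] at h1
    exact mul_right_cancel h1
  exact Fin.ext (pow_injOn_Iio_orderOf (by simp [ho]) (by simp [ho]) h2)

theorem exists_pow_succ_eq (hF : Fintype.card F = q) (hα : ∀ x : Fˣ, x ∈ Subgroup.zpowers α)
    {z : F} (hz : z ≠ 0) : ∃ i : Fin (q - 1), (α : F) ^ (i.val + 1) = z := by
  -- an injective map between finite sets of the same cardinality
  let f : Fin (q - 1) → Fˣ := fun i => α ^ (i.val + 1)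
  have hf : Function.Injective f := fun i j hij =>
    pow_succ_injective hF hα (by simpa [f] using congrArg Units.val hij)
  have hb : Function.Bijective f := (Fintype.bijective_iff_injective_and_card f).2
    ⟨hf, by rw [Fintype.card_fin, Fintype.card_units, hF]⟩
  obtain ⟨i, hi⟩ := hb.2 (Units.mk0 z hz)
  exact ⟨i, by simpa [f] using congrArg Units.val hi⟩

/-- What `exists_third_root` says about the coordinates of `codeD`: the coefficients of a
codeword that vanishes at `i`, `j` and a coordinate other than the third one are zero. -/
theorem exists_third_coordinate {m h : ℕ} (hmh : Nat.gcd m h = 1) (hq : q = 2 ^ m)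
    (hF : Fintype.card F = q) (hα : ∀ x : Fˣ, x ∈ Subgroup.zpowers α) {i j : Fin (q - 1)}
    (hij : i ≠ j) :
    ∃ k, k ≠ i ∧ k ≠ j ∧ ∀ a b d : F, ∀ c : Fin (q - 1) → F,
      (∀ i : Fin (q - 1),
        c i = a + b * (α : F) ^ (i.val + 1) + d * ((α : F) ^ (i.val + 1)) ^ (2 ^ h + 1)) →
      c i = 0 → c j = 0 → c k = 0 ∧ ∀ l, l ≠ i → l ≠ j → l ≠ k → c l = 0 →
        a = 0 ∧ b = 0 ∧ d = 0 := by
  have hchar : CharP F 2 := by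
    refine charP_of_card_eq_prime_pow (p := 2) (f := m) ?_
    rw [hF, hq]
  have hinj := pow_succ_injective hF hα
  obtain ⟨z, hz0, hzi, hzj, hz⟩ := exists_third_root (σ := iterateFrobenius F 2 h)
    (fun s hs hs0 => eq_zero_or_one_of_pow_eq hmh (hF.trans hq) hs hs0)
    (pow_ne_zero (i.val + 1) α.ne_zero) (pow_ne_zero (j.val + 1) α.ne_zero) (hinj.ne hij)
  obtain ⟨k, rfl⟩ := exists_pow_succ_eq hF hα hz0
  have hpow : ∀ s : F, s ^ (2 ^ h + 1) = s * iterateFrobenius F 2 h s := fun s => by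
    rw [iterateFrobenius_def, pow_succ, mul_comm]
  refine ⟨k, fun e => hzi (by rw [e]), fun e => hzj (by rw [e]), fun a b d c hc hi hj => ?_⟩
  simp only [hc, hpow] at hi hj ⊢
  obtain ⟨h1, h2⟩ := hz a b d hi hj
  exact ⟨h1, fun l hli hlj hlk hl => h2 _ (hinj.ne hli) (hinj.ne hlj) (hinj.ne hlk) hl⟩

theorem hasThirdPoints_codeD {m h : ℕ} (hmh : Nat.gcd m h = 1) (hq : q = 2 ^ m)
    (hF : Fintype.card F = q) (hα : ∀ x : Fˣ, x ∈ Subgroup.zpowers α) :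
    HasThirdPoints (codeD α h q) := by
  intro i j hij
  obtain ⟨k, hki, hkj, hk⟩ := exists_third_coordinate hmh hq hF hα hij
  refine ⟨k, hki, hkj, fun c hc hi hj => ?_⟩
  obtain ⟨a, b, d, habd⟩ := mem_codeD.1 hc
  obtain ⟨h1, h2⟩ := hk a b d c habd hi hj
  refine ⟨h1, fun l hli hlj hlk hl => ?_⟩
  obtain ⟨rfl, rfl, rfl⟩ := h2 l hli hlj hlk hl
  ext i
  simp [habd]

theorem finrank_codeD {m h : ℕ} (hmh : Nat.gcd m h = 1) (hm : 3 ≤ m) (hq : q = 2 ^ m)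
    (hF : Fintype.card F = q) (hα : ∀ x : Fˣ, x ∈ Subgroup.zpowers α) :
    Module.finrank F (codeD α h q) = 3 := by
  have hq8 : 8 ≤ q := hq ▸ Nat.pow_le_pow_right (n := 2) (by norm_num) hm
  have hli : LinearIndependent F (matrixD α h q).row := by
    refine Matrix.vecMul_injective_iff.1 ?_
    rw [← Matrix.coe_vecMulLinear, injective_iff_map_eq_zero]
    intro a ha
    let i : Fin (q - 1) := ⟨0, by omega⟩
    let j : Fin (q - 1) := ⟨1, by omega⟩
    have hij : i ≠ j := by simp [i, j]
    obtain ⟨k, -, -, hk⟩ := exists_third_coordinate (h := h) hmh hq hF hα hij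
    obtain ⟨l, -, hl⟩ := Finset.exists_mem_notMem_of_card_lt_card
      (s := {i, j, k}) (t := (Finset.univ : Finset (Fin (q - 1)))) (by
        have : ({i, j, k} : Finset (Fin (q - 1))).card ≤ 3 := Finset.card_le_three
        rw [Finset.card_univ, Fintype.card_fin]
        omega)
    simp only [Finset.mem_insert, Finset.mem_singleton, not_or] at hl
    obtain ⟨h0, h1, h2⟩ := (hk (a 0) (a 1) (a 2) 0 (fun i => by
      rw [← ha]
      exact vecMul_matrixD a i) rfl rfl).2 l hl.1 hl.2.1
      hl.2.2 rfl
    ext n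
    fin_cases n
    · exact h0
    · exact h1
    · exact h2
  rw [codeD, ← Matrix.rank_eq_finrank_span_row, hli.rank_matrix, Fintype.card_fin]

end Code

end CodeDesign

theorem theorem3p1 {F : Type*} [Field F] [Fintype F] [DecidableEq F]
    (m h q : ℕ) (hm : 3 ≤ m) (hh : 0 < h) (hmh : Nat.gcd m h = 1)
    (hq : q = 2 ^ m) (hF : Fintype.card F = q)
    (α : Fˣ) (hα : ∀ x : Fˣ, x ∈ Subgroup.zpowers α) :
    CodeDesign.IsLinearCode (CodeDesign.codeD α h q) (q - 1) 3 (q - 4) ∧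
    CodeDesign.IsNMDS (CodeDesign.codeD α h q) ∧
    CodeDesign.weightEnumerator (CodeDesign.codeD α h q) =
      1 + C (((q : ℚ) - 1) ^ 2 * ((q : ℚ) - 2) / 6) * X ^ (q - 4)
        + C (((q : ℚ) - 1) ^ 2 * ((q : ℚ) + 4) / 2) * X ^ (q - 2)
        + C (((q : ℚ) - 1) * ((q : ℚ) ^ 2 + 8) / 3) * X ^ (q - 1) ∧
    CodeDesign.IsSimpleDesign (CodeDesign.blocks (CodeDesign.codeD α h q) (q - 4))
      2 (q - 1) (q - 4) ((q - 4) * (q - 5) / 6) ∧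
    CodeDesign.IsLinearCode (CodeDesign.dual (CodeDesign.codeD α h q)) (q - 1) (q - 4) 3 ∧
    CodeDesign.IsSimpleDesign (CodeDesign.blocks (CodeDesign.dual (CodeDesign.codeD α h q)) 3)
      2 (q - 1) 3 1 ∧
    CodeDesign.IsSteinerSystem (CodeDesign.blocks (CodeDesign.dual (CodeDesign.codeD α h q)) 3)
      2 3 (q - 1) ∧
    CodeDesign.IsSimpleDesign (CodeDesign.blocks (CodeDesign.dual (CodeDesign.codeD α h q)) 4)
      2 (q - 1) 4 ((q - 4) * (q - 7) / 2) := by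
  have hq8 : 8 ≤ q := hq ▸ Nat.pow_le_pow_right (n := 2) (by norm_num) hm
  have hι : Fintype.card (Fin (q - 1)) = q - 1 := Fintype.card_fin _
  have hC := CodeDesign.hasThirdPoints_codeD (h := h) hmh hq hF hα
  have h3 := CodeDesign.finrank_codeD (h := h) hmh hm hq hF hα
  have hd : Module.finrank F (CodeDesign.dual (CodeDesign.codeD α h q)) =
      Fintype.card (Fin (q - 1)) - 3 := by
    have := CodeDesign.finrank_dual_span_row (CodeDesign.matrixD α h q)
    change Module.finrank F (CodeDesign.codeD α h q) + _ = _ at this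
    rw [h3] at this
    exact Nat.eq_sub_of_add_eq' this
  have hlin := CodeDesign.isLinearCode_of_hasThirdPoints hC h3 (by omega)
  have hlin' := CodeDesign.isLinearCode_dual hC h3 (by omega) hd
  have hmin := hC.isSimpleDesign h3 (by omega)
  have hthree := hC.isSimpleDesign_dual_three h3 (by omega)
  have hfour := hC.isSimpleDesign_dual_four h3 (by omega)
  have hnmds : CodeDesign.IsNMDS (CodeDesign.codeD α h q) := by
    refine ⟨?_, ?_⟩
    · rw [CodeDesign.IsAMDS, h3]
      exact hlin
    · rw [CodeDesign.IsAMDS, hd, Nat.sub_sub_self (by omega)]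
      exact hlin'
  simp only [hι, Nat.sub_sub, Nat.reduceAdd] at hlin hlin' hmin hthree hfour
  exact ⟨hlin, hnmds, hC.weightEnumerator_eq h3 hF hι (by omega), hmin, hlin', hthree,
    ⟨le_rfl, hthree.1⟩, hfour⟩
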